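/- Let $k$ be a field and let $X$ be a commutative Hopf $k$-algebra with comultiplication $\Delta$, counit $\varepsilon$ and antipode $S$. A subset $I\subseteq X$ is called a Hopf ideal if $I=f^{-1}(0)$ for some morphism $f\colon X\to Y$ of commutative Hopf $k$-algebras, and a normal Hopf ideal if moreover $f$ can be chosen to be a cokernel (of some morphism $W\to X$) in the category of commutative Hopf $k$-algebras, whose zero morphisms $A\to B$ are the composites $A\xrightarrow{\varepsilon_A}k\to B$ of counit and unit. Let $I$ be a Hopf ideal of $X$. Then the following are equivalent. 1. $I$ is a normal Hopf ideal. 2. $I=XA^+$ for some Hopf subalgebra $A$ of $X$, where $A^+=\ker(\varepsilon|_A\colon A\to k)$ is the augmentation ideal of $A$ and $XA^+$ is the ideal of $X$ generated by $A^+$. 3. For each $x\in I$ we have $x_1S(x_3)\otimes x_2\in X\otimes I$, a subspace of $X\otimes_k X$. Here $x_1\otimes x_2\otimes x_3=(\mathrm{id}\otimes\Delta)\Delta(x)$ in Sweedler's notation. -/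

import Mathlib

open CategoryTheory CategoryTheory.Limits
open scoped TensorProduct

universe u

namespace CommHopfAlgCat

variable {k : Type u} [CommRing k]

/-- The zero morphisms of the pointed category of commutative Hopf `k`-algebras: the zero
morphism `A ⟶ B` is the composite `A ⟶ k ⟶ B` of the counit of `A` and the unit of `B`. -/
noncomputable instance instHasZeroMorphisms : HasZeroMorphisms (CommHopfAlgCat.{u} k) where
  zero A B := ⟨ofHom ((Bialgebra.unitBialgHom k B).comp (Bialgebra.counitBialgHom k A))⟩
  comp_zero {A B} f C := by
    apply hom_ext
    apply BialgHom.ext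
    intro x
    change algebraMap k C (Coalgebra.counit (R := k) (f.hom x)) =
      algebraMap k C (Coalgebra.counit (R := k) x)
    rw [CoalgHomClass.counit_comp_apply]
  zero_comp A {B C} f := by
    apply hom_ext
    apply BialgHom.ext
    intro x
    change f.hom (algebraMap k B (Coalgebra.counit (R := k) x)) =
      algebraMap k C (Coalgebra.counit (R := k) x)
    exact AlgHomClass.commutes f.hom _

theorem zero_apply {A B : CommHopfAlgCat.{u} k} (x : A) :
    (0 : A ⟶ B).hom x = algebraMap k B (Coalgebra.counit (R := k) x) :=
  rfl

/-- The ground ring is a zero object, so the zero morphisms above are those of the pointed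
category. -/
theorem isZero_ground : IsZero (CommHopfAlgCat.of k k : CommHopfAlgCat.{u} k) := by
  refine (IsZero.iff_id_eq_zero _).2 ?_
  apply hom_ext
  apply BialgHom.ext
  intro x
  rfl

end CommHopfAlgCat

namespace CommHopf

variable (k : Type u) [CommRing k] {X : Type u} [CommRing X] [HopfAlgebra k X]

/-- `I` is a Hopf ideal: `I = f⁻¹(0)` for some morphism `f : X ⟶ Y` of commutative Hopf
`k`-algebras. -/
def IsHopfIdeal (I : Ideal X) : Prop :=
  ∃ (Y : CommHopfAlgCat.{u} k) (f : CommHopfAlgCat.of k X ⟶ Y), (I : Set X) = f.hom ⁻¹' {0}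

/-- `I` is a normal Hopf ideal: `I = f⁻¹(0)` for some morphism `f : X ⟶ Y` which is a cokernel
(of some morphism `W ⟶ X`) in the category of commutative Hopf `k`-algebras. -/
def IsNormalHopfIdeal (I : Ideal X) : Prop :=
  ∃ (Y : CommHopfAlgCat.{u} k) (f : CommHopfAlgCat.of k X ⟶ Y),
    Nonempty (NormalEpi f) ∧ (I : Set X) = f.hom ⁻¹' {0}

variable {k}

/-- A subalgebra `A` of `X` is a Hopf subalgebra if `Δ(A) ⊆ A ⊗ A` (as a subspace of `X ⊗ X`)
and `S(A) ⊆ A`. -/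
structure IsHopfSubalgebra (A : Subalgebra k X) : Prop where
  comul_mem : ∀ a ∈ A, Coalgebra.comul (R := k) a ∈
    LinearMap.range (TensorProduct.mapIncl (Subalgebra.toSubmodule A) (Subalgebra.toSubmodule A))
  antipode_mem : ∀ a ∈ A, HopfAlgebra.antipode k a ∈ A

/-- The augmentation ideal `A⁺` of `A`: the kernel of the counit of `X` restricted to `A`. -/
noncomputable def augmentationIdeal (A : Subalgebra k X) : Ideal A :=
  RingHom.ker ((Bialgebra.counitAlgHom k X).comp A.val)

variable (k X) in
/-- The linear map `X ⊗ X ⊗ X → X ⊗ X`, `a ⊗ b ⊗ c ↦ a S(c) ⊗ b`. -/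
noncomputable def mulAntipodeOuter : X ⊗[k] (X ⊗[k] X) →ₗ[k] X ⊗[k] X :=
  (LinearMap.mul' k X ∘ₗ (HopfAlgebra.antipode k).lTensor X).rTensor X ∘ₗ
    (TensorProduct.assoc k X X X).symm.toLinearMap ∘ₗ
    (TensorProduct.comm k X X).toLinearMap.lTensor X

theorem mulAntipodeOuter_tmul (a b c : X) :
    mulAntipodeOuter k X (a ⊗ₜ (b ⊗ₜ c)) = (a * HopfAlgebra.antipode k c) ⊗ₜ b := by
  simp [mulAntipodeOuter]

variable (k X) in
/-- The linear map `X → X ⊗ X`, `x ↦ x₁ S(x₃) ⊗ x₂`. -/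
noncomputable def coadjoint : X →ₗ[k] X ⊗[k] X :=
  mulAntipodeOuter k X ∘ₗ (Coalgebra.comul (R := k) (A := X)).lTensor X ∘ₗ Coalgebra.comul

variable (k) in
/-- The subspace `X ⊗ I` of `X ⊗ X`. -/
noncomputable def tensorIdeal (I : Ideal X) : Submodule k (X ⊗[k] X) :=
  LinearMap.range ((I.restrictScalars k).subtype.lTensor X)

end CommHopf

/-!
Think of `X` as the functions on an affine group scheme `G` and of the Hopf ideal `I` as a closed
subgroup `N`; condition 3 says that `N` is stable under conjugation. The cokernel of `W → X` is
`X ⧸ X W⁺`, the functions on the fibre of `G → Spec W` over the unit, which gives 1 ⇔ 2, and such a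
fibre is stable under conjugation, which gives 2 ⇒ 3.

For 3 ⇒ 2 let `A` be the algebra of functions on `G ⧸ N` and `J = X A⁺ ⊆ I`. Given a
finite-dimensional right coideal `V` of `X`, take a basis adapted to `V ∩ I`; on `N` its coefficient
matrix is block triangular. The maximal minors of the first block column are therefore
semi-invariant under `N`, all of the same weight `c`, the leading minor. The conjugates of `c` give
rise to a finite-dimensional algebra of functions on `G ⧸ N`; a socle element `s` of it makes
`s c⁻¹` semi-invariant of weight `c⁻¹`. Multiplied by a suitable such semi-invariant, the minors
descend to `G ⧸ N`, hence are constant modulo `J`. By Cramer's rule the block below the leading one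
then vanishes modulo `J`, so `V ∩ I ⊆ J`.
-/

namespace CommHopf

open Algebra.TensorProduct WithConv

section ProductMap

variable {k A B C D R S : Type*} [CommRing k] [CommRing A] [Algebra k A] [CommRing B]
  [Algebra k B] [CommRing C] [Algebra k C] [CommRing D] [Algebra k D] [CommRing R] [Algebra k R]
  [CommRing S] [Algebra k S]

theorem comp_productMap (h : R →ₐ[k] S) (f : A →ₐ[k] R) (g : B →ₐ[k] R) :
    h.comp (productMap f g) = productMap (h.comp f) (h.comp g) := by
  ext <;> simp

theorem productMap_comp_map (f : C →ₐ[k] R) (g : D →ₐ[k] R) (a : A →ₐ[k] C) (b : B →ₐ[k] D) :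
    (productMap f g).comp (map a b) = productMap (f.comp a) (g.comp b) := by
  ext <;> simp

theorem map_eq_productMap (f : A →ₐ[k] R) (g : B →ₐ[k] S) :
    map f g = productMap ((includeLeft : R →ₐ[k] R ⊗[k] S).comp f)
      ((includeRight : S →ₐ[k] R ⊗[k] S).comp g) := by
  ext <;> simp

end ProductMap

section Points

variable {k X R S : Type*} [CommRing k] [CommRing X] [HopfAlgebra k X] [CommRing R] [Algebra k R]
  [CommRing S] [Algebra k S]

variable (k X R) in
/-- The `R`-points of the affine group scheme represented by `X`; the group law is convolution. -/
abbrev Points := WithConv (X →ₐ[k] R)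

noncomputable instance : Group (Points k X R) where
  inv g := toConv (g.ofConv.comp (HopfAlgebra.antipodeAlgHom k X))
  inv_mul_cancel g := by
    have h : toConv (HopfAlgebra.antipodeAlgHom k X) * toConv (AlgHom.id k X) = 1 :=
      inv_mul_cancel (toConv (AlgHom.id k X))
    have h' := AlgHom.comp_convMul_distrib g.ofConv (toConv (HopfAlgebra.antipodeAlgHom k X))
      (toConv (AlgHom.id k X))
    rw [h] at h'
    refine WithConv.ext (h'.symm.trans ?_)
    ext x
    exact g.ofConv.commutes _

theorem points_ext {g n : Points k X R} (h : ∀ x, g x = n x) : g = n :=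
  WithConv.ext (AlgHom.ext h)

theorem points_mul_ofConv (g n : Points k X R) :
    (g * n).ofConv = (productMap g.ofConv n.ofConv).comp (Bialgebra.comulAlgHom k X) :=
  AlgHom.ext (AlgHom.convMul_apply g n)

theorem points_mul_apply (g n : Points k X R) (x : X) :
    (g * n) x = productMap g.ofConv n.ofConv (Coalgebra.comul (R := k) x) :=
  AlgHom.convMul_apply g n x

theorem points_inv_apply (g : Points k X R) (x : X) : g⁻¹ x = g (HopfAlgebra.antipode k x) := rfl

theorem points_one_apply (x : X) :
    (1 : Points k X R) x = algebraMap k R (Coalgebra.counit x) := rfl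

/-- Change of coefficients for points. -/
noncomputable def mapPoint (h : R →ₐ[k] S) : Points k X R →* Points k X S where
  toFun g := toConv (h.comp g.ofConv)
  map_one' := points_ext fun x => h.commutes (Coalgebra.counit x)
  map_mul' f g := WithConv.ext (AlgHom.comp_convMul_distrib h f g)

@[simp]
theorem mapPoint_apply (h : R →ₐ[k] S) (g : Points k X R) (x : X) :
    mapPoint h g x = h (g x) := rfl

theorem mapPoint_comp {T : Type*} [CommRing T] [Algebra k T] (h : S →ₐ[k] T) (f : R →ₐ[k] S)
    (g : Points k X R) : mapPoint (h.comp f) g = mapPoint h (mapPoint f g) := rfl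

/-- Restriction of points along a homomorphism of Hopf algebras. -/
noncomputable def restrictPoint {W : Type*} [CommRing W] [HopfAlgebra k W] (f : W →ₐc[k] X) :
    Points k X R →* Points k W R where
  toFun g := toConv (g.ofConv.comp f)
  map_one' := points_ext fun w =>
    congrArg (algebraMap k R) (CoalgHomClass.counit_comp_apply f w)
  map_mul' g n := WithConv.ext (AlgHom.convMul_comp_bialgHom_distrib g n f)

theorem bialgHom_antipode {W : Type*} [CommRing W] [HopfAlgebra k W] (f : W →ₐc[k] X) (w : W) :
    f (HopfAlgebra.antipode k w) = HopfAlgebra.antipode k (f w) :=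
  DFunLike.congr_fun (congrArg ofConv (map_inv (restrictPoint f) (toConv (AlgHom.id k X)))).symm w

variable (k X) in
theorem productMap_antipode_id_comp_comul :
    (productMap (HopfAlgebra.antipodeAlgHom k X) (.id k X)).comp (Bialgebra.comulAlgHom k X) =
      (Algebra.ofId k X).comp (Bialgebra.counitAlgHom k X) :=
  (points_mul_ofConv _ _).symm.trans <|
    congrArg ofConv (inv_mul_cancel (toConv (.id k X) : Points k X X))

variable (k X) in
theorem productMap_id_antipode_comp_comul :
    (productMap (.id k X) (HopfAlgebra.antipodeAlgHom k X)).comp (Bialgebra.comulAlgHom k X) =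
      (Algebra.ofId k X).comp (Bialgebra.counitAlgHom k X) :=
  (points_mul_ofConv _ _).symm.trans <|
    congrArg ofConv (mul_inv_cancel (toConv (.id k X) : Points k X X))

/-- The point `n` lies in the closed subscheme cut out by `I`. -/
def VanishesOn (I : Ideal X) (n : Points k X R) : Prop := ∀ x ∈ I, n x = 0

variable {I : Ideal X} {n m : Points k X R}

theorem VanishesOn.mapPoint (hn : VanishesOn I n) (h : R →ₐ[k] S) :
    VanishesOn I (mapPoint h n) := fun x hx => by
  rw [mapPoint_apply, hn x hx, map_zero]

variable (k) in
/-- The generic point of the closed subscheme cut out by `I`. -/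
noncomputable def quotientPoint (I : Ideal X) : Points k X (X ⧸ I) :=
  toConv (Ideal.Quotient.mkₐ k I)

theorem vanishesOn_quotientPoint (I : Ideal X) : VanishesOn I (quotientPoint k I) :=
  fun _ hx => Ideal.Quotient.eq_zero_iff_mem.2 hx

/-- The homomorphism `X ⧸ I → R` induced by a point that vanishes on `I`. -/
noncomputable def VanishesOn.lift (hn : VanishesOn I n) : X ⧸ I →ₐ[k] R :=
  Ideal.Quotient.liftₐ I n.ofConv hn

theorem VanishesOn.lift_comp_mk (hn : VanishesOn I n) :
    hn.lift.comp (Ideal.Quotient.mkₐ k I) = n.ofConv := rfl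

theorem isHopfIdeal_of_vanishesOn (h_one : VanishesOn I (1 : Points k X k))
    (h_mul : ∀ n m : Points k X ((X ⧸ I) ⊗[k] (X ⧸ I)),
      VanishesOn I n → VanishesOn I m → VanishesOn I (n * m))
    (h_inv : ∀ n : Points k X (X ⧸ I), VanishesOn I n → VanishesOn I n⁻¹) :
    I.IsHopfIdeal k where
  counit_eq_zero := h_one
  map_mkQ_comul_eq_zero x hx := by
    have hν := vanishesOn_quotientPoint (k := k) I
    have h := h_mul _ _ (hν.mapPoint includeLeft) (hν.mapPoint includeRight) x hx
    rw [points_mul_apply] at h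
    change map (Ideal.Quotient.mkₐ k I) (Ideal.Quotient.mkₐ k I) (Coalgebra.comul (R := k) x) = 0
    rw [map_eq_productMap]
    exact h
  antipode_mem x hx := Ideal.Quotient.eq_zero_iff_mem.1 <|
    h_inv _ (vanishesOn_quotientPoint I) x hx

section IsHopfIdeal

variable [I.IsHopfIdeal k]

theorem VanishesOn.mul (hn : VanishesOn I n) (hm : VanishesOn I m) : VanishesOn I (n * m) := by
  intro x hx
  have h : map (Ideal.Quotient.mkₐ k I) (Ideal.Quotient.mkₐ k I)
      (Coalgebra.comul (R := k) x) = 0 :=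
    Submodule.IsCoideal.map_mkQ_comul_eq_zero (R := k) (I := I.restrictScalars k) hx
  rw [points_mul_apply, ← hn.lift_comp_mk, ← hm.lift_comp_mk, ← productMap_comp_map,
    AlgHom.comp_apply, h, map_zero]

theorem VanishesOn.inv (hn : VanishesOn I n) : VanishesOn I n⁻¹ := fun _ hx =>
  hn _ (Ideal.IsHopfIdeal.antipode_mem (R := k) hx)

end IsHopfIdeal

end Points

section Conjugation

variable {k X : Type u} [CommRing k] [CommRing X] [HopfAlgebra k X] {I : Ideal X}

theorem productMap_mulAntipodeOuter {R : Type*} [CommRing R] [Algebra k R] (g n : Points k X R)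
    (z : X ⊗[k] (X ⊗[k] X)) :
    productMap g.ofConv n.ofConv (mulAntipodeOuter k X z) =
      productMap g.ofConv (productMap n.ofConv g⁻¹.ofConv) z := by
  suffices h : (productMap g.ofConv n.ofConv).toLinearMap ∘ₗ mulAntipodeOuter k X =
      (productMap g.ofConv (productMap n.ofConv g⁻¹.ofConv)).toLinearMap from
    LinearMap.congr_fun h z
  refine TensorProduct.ext_threefold' fun a b c => ?_
  simp only [LinearMap.comp_apply, mulAntipodeOuter_tmul, AlgHom.toLinearMap_apply,
    productMap_apply_tmul, map_mul]
  rw [mul_assoc, mul_comm (n.ofConv b)]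
  rfl

theorem conj_apply {R : Type*} [CommRing R] [Algebra k R] (g n : Points k X R) (x : X) :
    (g * n * g⁻¹) x = productMap g.ofConv n.ofConv (coadjoint k X x) := by
  have hcomp : (productMap g.ofConv (productMap n.ofConv g⁻¹.ofConv)).comp
      (map (.id k X) (Bialgebra.comulAlgHom k X)) =
        productMap g.ofConv (n * g⁻¹).ofConv := by
    rw [productMap_comp_map, AlgHom.comp_id]
    congr 1
    exact AlgHom.ext fun y => (points_mul_apply n g⁻¹ y).symm
  rw [mul_assoc, points_mul_apply, ← hcomp]
  exact (productMap_mulAntipodeOuter g n _).symm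

theorem mem_tensorIdeal_iff (z : X ⊗[k] X) :
    z ∈ tensorIdeal k I ↔ map (.id k X) (Ideal.Quotient.mkₐ k I) z = 0 :=
  (lTensor_exact X (LinearMap.exact_subtype_mkQ (I.restrictScalars k))
    (I.restrictScalars k).mkQ_surjective z).symm

variable (k) in
/-- The closed subscheme cut out by `I` is stable under conjugation. -/
def IsConjStable (I : Ideal X) : Prop :=
  ∀ (R : Type u) [CommRing R] [Algebra k R] (g n : Points k X R),
    VanishesOn I n → VanishesOn I (g * n * g⁻¹)

theorem isConjStable_iff_coadjoint_mem :
    IsConjStable k I ↔ ∀ x ∈ I, coadjoint k X x ∈ tensorIdeal k I := by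
  simp only [mem_tensorIdeal_iff]
  constructor
  · intro h x hx
    have := h (X ⊗[k] (X ⧸ I)) (toConv includeLeft) (mapPoint includeRight (quotientPoint k I))
      ((vanishesOn_quotientPoint I).mapPoint _) x hx
    rw [conj_apply] at this
    rwa [map_eq_productMap]
  · intro h R _ _ g n hn x hx
    rw [conj_apply, ← hn.lift_comp_mk, ← AlgHom.comp_id g.ofConv, ← productMap_comp_map,
      AlgHom.comp_apply, h x hx, map_zero]

end Conjugation

section MapAugmentation

variable {k X W R : Type*} [CommRing k] [CommRing X] [HopfAlgebra k X] [CommRing W]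
  [HopfAlgebra k W] [CommRing R] [Algebra k R]

/-- The ideal `X f(W⁺)` of `X` generated by the image of the augmentation ideal of `W`. -/
noncomputable def mapAugmentation (f : W →ₐc[k] X) : Ideal X :=
  Ideal.map (f : W →ₐ[k] X) (RingHom.ker (Bialgebra.counitAlgHom k W))

theorem mapAugmentation_le_ker_iff (f : W →ₐc[k] X) (n : X →ₐ[k] R) :
    mapAugmentation f ≤ RingHom.ker n ↔ ∀ w, n (f w) = algebraMap k R (Coalgebra.counit w) := by
  rw [mapAugmentation, Ideal.map_le_iff_le_comap]
  constructor
  · intro h w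
    have hw : w - algebraMap k W (Coalgebra.counit w) ∈
        RingHom.ker (Bialgebra.counitAlgHom k W) := by
      simp [RingHom.mem_ker]
    have hn : n (f (w - algebraMap k W (Coalgebra.counit w))) = 0 := h hw
    rwa [map_sub, map_sub, AlgHomClass.commutes, AlgHom.commutes, sub_eq_zero] at hn
  · intro h w hw
    have hw : Coalgebra.counit (R := k) w = 0 := hw
    exact (h w).trans (by rw [hw, map_zero])

theorem vanishesOn_mapAugmentation_iff (f : W →ₐc[k] X) (n : Points k X R) :
    VanishesOn (mapAugmentation f) n ↔ restrictPoint f n = 1 :=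
  (mapAugmentation_le_ker_iff f n.ofConv).trans
    ⟨fun h => points_ext h, fun h => DFunLike.congr_fun (congrArg ofConv h)⟩

instance isHopfIdeal_mapAugmentation (f : W →ₐc[k] X) : (mapAugmentation f).IsHopfIdeal k := by
  refine isHopfIdeal_of_vanishesOn ?_ (fun n m hn hm => ?_) fun n hn => ?_ <;>
    rw [vanishesOn_mapAugmentation_iff] at *
  · exact map_one _
  · rw [map_mul, hn, hm, mul_one]
  · rw [map_inv, hn, inv_one]

end MapAugmentation

section Image

variable {k X : Type u} {W : Type*} [CommRing k] [CommRing X] [HopfAlgebra k X] [CommRing W]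
  [HopfAlgebra k W]

theorem isConjStable_mapAugmentation (f : W →ₐc[k] X) : IsConjStable k (mapAugmentation f) := by
  intro R _ _ g n hn
  rw [vanishesOn_mapAugmentation_iff] at *
  rw [map_mul, map_mul, hn, mul_one, ← map_mul, mul_inv_cancel, map_one]

theorem isHopfSubalgebra_range (g : W →ₐc[k] X) :
    IsHopfSubalgebra (g : W →ₐ[k] X).range where
  comul_mem := by
    rintro _ ⟨w, rfl⟩
    refine ⟨map (g : W →ₐ[k] X).rangeRestrict (g : W →ₐ[k] X).rangeRestrict
      (Coalgebra.comul (R := k) w), ?_⟩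
    have h_range : (map (g : W →ₐ[k] X).range.val (g : W →ₐ[k] X).range.val).comp
        (map (g : W →ₐ[k] X).rangeRestrict (g : W →ₐ[k] X).rangeRestrict) = map g g := by
      rw [← map_comp, AlgHom.val_comp_rangeRestrict]
    exact (DFunLike.congr_fun h_range _).trans (CoalgHomClass.map_comp_comul_apply g w)
  antipode_mem := by
    rintro _ ⟨w, rfl⟩
    exact ⟨HopfAlgebra.antipode k w, bialgHom_antipode g w⟩

theorem mapAugmentation_eq_map_range (g : W →ₐc[k] X) :
    mapAugmentation g =
      Ideal.map (g : W →ₐ[k] X).range.val (augmentationIdeal (g : W →ₐ[k] X).range) := by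
  have h_counit (w : W) : Coalgebra.counit (R := k) (g w) = Coalgebra.counit w :=
    CoalgHomClass.counit_comp_apply g w
  refine le_antisymm (Ideal.map_le_iff_le_comap.2 fun w hw => ?_)
    (Ideal.map_le_iff_le_comap.2 ?_)
  · exact Ideal.mem_map_of_mem (x := (g : W →ₐ[k] X).rangeRestrict w) _ ((h_counit w).trans hw)
  · rintro ⟨_, w, rfl⟩ hw
    exact Ideal.mem_map_of_mem (g : W →ₐ[k] X) ((h_counit w).symm.trans hw)

end Image

section HopfSubalgebra

variable {k X : Type u} [Field k] [CommRing X] [HopfAlgebra k X]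

theorem map_injective {A B C D : Type*} [CommRing A] [Algebra k A] [CommRing B] [Algebra k B]
    [CommRing C] [Algebra k C] [CommRing D] [Algebra k D] {f : A →ₐ[k] B} {g : C →ₐ[k] D}
    (hf : Function.Injective f) (hg : Function.Injective g) : Function.Injective (map f g) :=
  TensorProduct.map_injective_of_flat_flat f.toLinearMap g.toLinearMap hf hg

namespace IsHopfSubalgebra

variable {A : Subalgebra k X}

theorem map_val_injective (A : Subalgebra k X) : Function.Injective (map A.val A.val) :=
  map_injective Subtype.val_injective Subtype.val_injective

/-- The comultiplication of a Hopf subalgebra. -/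
noncomputable def comulAlgHom (hA : IsHopfSubalgebra A) : A →ₐ[k] A ⊗[k] A :=
  (AlgEquiv.ofInjective _ (map_val_injective A)).symm.toAlgHom.comp
    (((Bialgebra.comulAlgHom k X).comp A.val).codRestrict _ fun a => hA.comul_mem a a.2)

/-- The counit of a Hopf subalgebra. -/
noncomputable def counitAlgHom (A : Subalgebra k X) : A →ₐ[k] k :=
  (Bialgebra.counitAlgHom k X).comp A.val

/-- The antipode of a Hopf subalgebra. -/
noncomputable def antipodeAlgHom (hA : IsHopfSubalgebra A) : A →ₐ[k] A :=
  ((HopfAlgebra.antipodeAlgHom k X).comp A.val).codRestrict A fun a => hA.antipode_mem a a.2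

theorem map_val_comp_comulAlgHom (hA : IsHopfSubalgebra A) :
    (map A.val A.val).comp hA.comulAlgHom = (Bialgebra.comulAlgHom k X).comp A.val :=
  AlgHom.ext fun a => congrArg Subtype.val ((AlgEquiv.ofInjective _
    (map_val_injective A)).apply_symm_apply ⟨Coalgebra.comul (R := k) (a : X), hA.comul_mem a a.2⟩)

theorem coassoc (hA : IsHopfSubalgebra A) :
    (Algebra.TensorProduct.assoc k k k A A A).toAlgHom.comp
      ((map hA.comulAlgHom (.id k A)).comp hA.comulAlgHom) =
        (map (.id k A) hA.comulAlgHom).comp hA.comulAlgHom := by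
  have h_inj := map_injective (f := A.val) Subtype.val_injective (map_val_injective A)
  refine (AlgHom.cancel_left h_inj).1 ?_
  have h_assoc : (map A.val (map A.val A.val)).comp
      (Algebra.TensorProduct.assoc k k k A A A).toAlgHom =
        (Algebra.TensorProduct.assoc k k k X X X).toAlgHom.comp
          (map (map A.val A.val) A.val) := by
    ext <;> rfl
  have h_left : (map (map A.val A.val) A.val).comp (map hA.comulAlgHom (.id k A)) =
      (map (Bialgebra.comulAlgHom k X) (.id k X)).comp (map A.val A.val) := by
    rw [← map_comp, ← map_comp, hA.map_val_comp_comulAlgHom]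
    rfl
  have h_right : (map A.val (map A.val A.val)).comp (map (.id k A) hA.comulAlgHom) =
      (map (.id k X) (Bialgebra.comulAlgHom k X)).comp (map A.val A.val) := by
    rw [← map_comp, ← map_comp, hA.map_val_comp_comulAlgHom]
    rfl
  rw [← AlgHom.comp_assoc, h_assoc, AlgHom.comp_assoc, ← AlgHom.comp_assoc _ _ hA.comulAlgHom,
    h_left, ← AlgHom.comp_assoc _ (map (.id k A) hA.comulAlgHom), h_right, AlgHom.comp_assoc,
    AlgHom.comp_assoc, hA.map_val_comp_comulAlgHom]
  exact AlgHom.ext fun a => Coalgebra.coassoc_apply (R := k) (a : X)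

theorem rTensor_counit_comp_comul (hA : IsHopfSubalgebra A) :
    (map (counitAlgHom A) (.id k A)).comp hA.comulAlgHom =
      (Algebra.TensorProduct.lid k A).symm := by
  have h_inj := map_injective (f := AlgHom.id k k) (g := A.val) Function.injective_id
    Subtype.val_injective
  refine (AlgHom.cancel_left h_inj).1 ?_
  have h_counit : (map (.id k k) A.val).comp (map (counitAlgHom A) (.id k A)) =
      (map (Bialgebra.counitAlgHom k X) (.id k X)).comp (map A.val A.val) := by
    rw [← map_comp, ← map_comp]
    rfl
  rw [← AlgHom.comp_assoc, h_counit, AlgHom.comp_assoc, hA.map_val_comp_comulAlgHom]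
  exact AlgHom.ext fun a => Coalgebra.rTensor_counit_comul (R := k) (a : X)

theorem lTensor_counit_comp_comul (hA : IsHopfSubalgebra A) :
    (map (.id k A) (counitAlgHom A)).comp hA.comulAlgHom =
      (Algebra.TensorProduct.rid k k A).symm := by
  have h_inj := map_injective (f := A.val) (g := AlgHom.id k k) Subtype.val_injective
    Function.injective_id
  refine (AlgHom.cancel_left h_inj).1 ?_
  have h_counit : (map A.val (.id k k)).comp (map (.id k A) (counitAlgHom A)) =
      (map (.id k X) (Bialgebra.counitAlgHom k X)).comp (map A.val A.val) := by
    rw [← map_comp, ← map_comp]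
    rfl
  rw [← AlgHom.comp_assoc, h_counit, AlgHom.comp_assoc, hA.map_val_comp_comulAlgHom]
  exact AlgHom.ext fun a => Coalgebra.lTensor_counit_comul (R := k) (a : X)

/-- The bialgebra structure of a Hopf subalgebra. -/
noncomputable abbrev bialgebra (hA : IsHopfSubalgebra A) : Bialgebra k A :=
  Bialgebra.ofAlgHom hA.comulAlgHom (counitAlgHom A) hA.coassoc hA.rTensor_counit_comp_comul
    hA.lTensor_counit_comp_comul

theorem productMap_antipode_id_comp_comul (hA : IsHopfSubalgebra A) :
    (productMap hA.antipodeAlgHom (.id k A)).comp hA.comulAlgHom =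
      (Algebra.ofId k A).comp (counitAlgHom A) := by
  refine (AlgHom.cancel_left (f := A.val) Subtype.val_injective).1 ?_
  have h_val : A.val.comp (productMap hA.antipodeAlgHom (.id k A)) =
      (productMap (HopfAlgebra.antipodeAlgHom k X) (.id k X)).comp (map A.val A.val) := by
    rw [comp_productMap, productMap_comp_map]
    rfl
  rw [← AlgHom.comp_assoc, h_val, AlgHom.comp_assoc, hA.map_val_comp_comulAlgHom,
    ← AlgHom.comp_assoc, CommHopf.productMap_antipode_id_comp_comul]
  rfl

theorem productMap_id_antipode_comp_comul (hA : IsHopfSubalgebra A) :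
    (productMap (.id k A) hA.antipodeAlgHom).comp hA.comulAlgHom =
      (Algebra.ofId k A).comp (counitAlgHom A) := by
  refine (AlgHom.cancel_left (f := A.val) Subtype.val_injective).1 ?_
  have h_val : A.val.comp (productMap (.id k A) hA.antipodeAlgHom) =
      (productMap (.id k X) (HopfAlgebra.antipodeAlgHom k X)).comp (map A.val A.val) := by
    rw [comp_productMap, productMap_comp_map]
    rfl
  rw [← AlgHom.comp_assoc, h_val, AlgHom.comp_assoc, hA.map_val_comp_comulAlgHom,
    ← AlgHom.comp_assoc, CommHopf.productMap_id_antipode_comp_comul]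
  rfl

/-- The Hopf algebra structure of a Hopf subalgebra. -/
noncomputable abbrev hopfAlgebra (hA : IsHopfSubalgebra A) : HopfAlgebra k A :=
  letI := hA.bialgebra
  HopfAlgebra.ofAlgHom hA.antipodeAlgHom hA.productMap_antipode_id_comp_comul
    hA.productMap_id_antipode_comp_comul

/-- The inclusion of a Hopf subalgebra. -/
noncomputable def valBialgHom (hA : IsHopfSubalgebra A) :
    letI := hA.hopfAlgebra
    A →ₐc[k] X :=
  letI := hA.hopfAlgebra
  BialgHom.ofAlgHom A.val rfl hA.map_val_comp_comulAlgHom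

end IsHopfSubalgebra

variable {W : Type u} [CommRing W] [HopfAlgebra k W]

theorem isHopfIdeal_ker (f : X →ₐc[k] W) : (RingHom.ker (f : X →ₐ[k] W)).IsHopfIdeal k where
  counit_eq_zero x (hx : f x = 0) := by rw [← CoalgHomClass.counit_comp_apply f x, hx, map_zero]
  map_mkQ_comul_eq_zero x (hx : f x = 0) := by
    let q := Ideal.Quotient.mkₐ k (RingHom.ker (f : X →ₐ[k] W))
    let i := Ideal.kerLiftAlg (f : X →ₐ[k] W)
    have h_inj := map_injective (Ideal.kerLiftAlg_injective (f : X →ₐ[k] W))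
      (Ideal.kerLiftAlg_injective (f : X →ₐ[k] W))
    have h_factor : (map i i).comp (map q q) = map (f : X →ₐ[k] W) (f : X →ₐ[k] W) := by
      rw [← map_comp]
      rfl
    change map q q (Coalgebra.comul x) = 0
    refine h_inj (Eq.trans ?_ (map_zero _).symm)
    refine (DFunLike.congr_fun h_factor (Coalgebra.comul x)).trans ?_
    refine (CoalgHomClass.map_comp_comul_apply f x).trans ?_
    rw [hx, map_zero]
  antipode_mem x (hx : f x = 0) := by
    change f (HopfAlgebra.antipode k x) = 0
    rw [bialgHom_antipode, hx, map_zero]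

theorem IsHopfIdeal.isHopfIdeal {I : Ideal X} (hI : IsHopfIdeal k I) : I.IsHopfIdeal k := by
  obtain ⟨Y, f, hf⟩ := hI
  obtain rfl : I = RingHom.ker (f.hom : X →ₐ[k] Y) := SetLike.coe_injective hf
  exact isHopfIdeal_ker f.hom

end HopfSubalgebra

section Cokernel

variable {k X W Y : Type u} [CommRing k] [CommRing X] [HopfAlgebra k X]
  [CommRing W] [HopfAlgebra k W] [CommRing Y] [HopfAlgebra k Y]

/-- The homomorphism of Hopf algebras `X ⧸ I → Y` induced by a homomorphism `X → Y` whose kernel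
contains the Hopf ideal `I`. -/
noncomputable def liftBialgHom (I : Ideal X) [I.IsHopfIdeal k] (f : X →ₐc[k] Y)
    (hf : I ≤ RingHom.ker (f : X →ₐ[k] Y)) : X ⧸ I →ₐc[k] Y :=
  BialgHom.ofAlgHom (Ideal.Quotient.liftₐ I (f : X →ₐ[k] Y) hf)
    (Ideal.Quotient.algHom_ext k (AlgHom.toLinearMap_injective (CoalgHomClass.counit_comp f)))
    (Ideal.Quotient.algHom_ext k <| by
      change ((Algebra.TensorProduct.map _ _).comp (Algebra.TensorProduct.map
        (Ideal.Quotient.mkₐ k I) (Ideal.Quotient.mkₐ k I))).comp (Bialgebra.comulAlgHom k X) = _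
      rw [← Algebra.TensorProduct.map_comp]
      exact AlgHom.toLinearMap_injective (CoalgHomClass.map_comp_comul f))

/-- The projection from `X` to `X ⧸ XW⁺`. -/
noncomputable abbrev cokernelπ (g : W →ₐc[k] X) :
    CommHopfAlgCat.of k X ⟶ CommHopfAlgCat.of k (X ⧸ mapAugmentation g) :=
  CommHopfAlgCat.ofHom (Bialgebra.Quotient.mkBialgHom (mapAugmentation g))

theorem comp_eq_zero_iff (g : W →ₐc[k] X) (f : X →ₐc[k] Y) :
    CommHopfAlgCat.ofHom g ≫ CommHopfAlgCat.ofHom f = 0 ↔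
      mapAugmentation g ≤ RingHom.ker (f : X →ₐ[k] Y) := by
  refine Iff.trans ⟨fun h w => ?_, fun h => ?_⟩ (mapAugmentation_le_ker_iff g (f : X →ₐ[k] Y)).symm
  · exact DFunLike.congr_fun (congrArg CommHopfAlgCat.Hom.hom h) w
  · exact CommHopfAlgCat.hom_ext (BialgHom.ext h)

theorem comp_cokernelπ (g : W →ₐc[k] X) : CommHopfAlgCat.ofHom g ≫ cokernelπ g = 0 :=
  (comp_eq_zero_iff g _).2 fun _ hx => Ideal.Quotient.eq_zero_iff_mem.2 hx

/-- The projection from `X` to `X ⧸ XW⁺` is a cokernel of `W → X`. -/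
noncomputable def isColimitCokernelπ (g : W →ₐc[k] X) :
    IsColimit (CokernelCofork.ofπ (cokernelπ g) (comp_cokernelπ g)) :=
  have : Epi (cokernelπ g) :=
    ConcreteCategory.epi_of_surjective _ (Ideal.Quotient.mk_surjective (I := mapAugmentation g))
  CokernelCofork.IsColimit.ofπ' _ _ fun f hf =>
    ⟨CommHopfAlgCat.ofHom (liftBialgHom _ f.hom ((comp_eq_zero_iff g f.hom).1 hf)), rfl⟩

theorem isNormalHopfIdeal_mapAugmentation (g : W →ₐc[k] X) :
    IsNormalHopfIdeal k (mapAugmentation g) :=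
  ⟨_, cokernelπ g, ⟨⟨_, CommHopfAlgCat.ofHom g, comp_cokernelπ g, isColimitCokernelπ g⟩⟩,
    Set.ext fun _ => Ideal.Quotient.eq_zero_iff_mem.symm⟩

theorem IsNormalHopfIdeal.exists_eq_mapAugmentation {I : Ideal X} (hI : IsNormalHopfIdeal k I) :
    ∃ (W : CommHopfAlgCat.{u} k) (g : W →ₐc[k] X), I = mapAugmentation g := by
  obtain ⟨Y, f, ⟨hf⟩, hIf⟩ := hI
  obtain rfl : I = RingHom.ker (f.hom : X →ₐ[k] Y) := SetLike.coe_injective hIf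
  refine ⟨hf.W, hf.g.hom, le_antisymm (fun x (hx : f.hom x = 0) => ?_)
    ((comp_eq_zero_iff hf.g.hom f.hom).1 hf.w)⟩
  let d := hf.isColimit.desc (CokernelCofork.ofπ (cokernelπ hf.g.hom) (comp_cokernelπ hf.g.hom))
  have h_fac : f ≫ d = cokernelπ hf.g.hom := hf.isColimit.fac _ WalkingParallelPair.one
  have h_mk : d.hom (f.hom x) = Ideal.Quotient.mk (mapAugmentation hf.g.hom) x :=
    DFunLike.congr_fun (congrArg CommHopfAlgCat.Hom.hom h_fac) x
  rw [hx, map_zero] at h_mk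
  exact Ideal.Quotient.eq_zero_iff_mem.1 h_mk.symm

end Cokernel

section Slices

variable {k : Type*} [CommRing k] {V M N : Type*} [AddCommGroup V] [Module k V]
  [AddCommGroup M] [Module k M] [AddCommGroup N] [Module k N]

/-- Contraction of the left factor of a tensor product with a linear form. -/
noncomputable def sliceLeft : Module.Dual k V →ₗ[k] V ⊗[k] M →ₗ[k] M :=
  (TensorProduct.lid k M).toLinearMap.compRight k ∘ₗ LinearMap.rTensorHom M

/-- Contraction of the right factor of a tensor product with a linear form. -/
noncomputable def sliceRight : Module.Dual k V →ₗ[k] M ⊗[k] V →ₗ[k] M :=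
  (TensorProduct.rid k M).toLinearMap.compRight k ∘ₗ LinearMap.lTensorHom M

@[simp]
theorem sliceLeft_tmul (φ : Module.Dual k V) (v : V) (m : M) :
    sliceLeft φ (v ⊗ₜ[k] m) = φ v • m := rfl

@[simp]
theorem sliceRight_tmul (φ : Module.Dual k V) (v : V) (m : M) :
    sliceRight φ (m ⊗ₜ[k] v) = φ v • m := rfl

theorem sliceLeft_lTensor (φ : Module.Dual k V) (f : M →ₗ[k] N) (z : V ⊗[k] M) :
    sliceLeft φ (f.lTensor V z) = f (sliceLeft φ z) := by
  suffices h : sliceLeft φ ∘ₗ f.lTensor V = f ∘ₗ sliceLeft φ from LinearMap.congr_fun h z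
  ext; simp

theorem sliceRight_rTensor (φ : Module.Dual k V) (f : M →ₗ[k] N) (z : M ⊗[k] V) :
    sliceRight φ (f.rTensor V z) = f (sliceRight φ z) := by
  suffices h : sliceRight φ ∘ₗ f.rTensor V = f ∘ₗ sliceRight φ from LinearMap.congr_fun h z
  ext; simp

theorem sliceRight_lTensor (φ : Module.Dual k N) (f : V →ₗ[k] N) (z : M ⊗[k] V) :
    sliceRight φ (f.lTensor M z) = sliceRight (φ ∘ₗ f) z := by
  suffices h : sliceRight φ ∘ₗ f.lTensor M = sliceRight (φ ∘ₗ f) from LinearMap.congr_fun h z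
  ext; simp

end Slices

section FieldSlices

variable {k : Type*} [Field k] {V M : Type*} [AddCommGroup V] [Module k V] [AddCommGroup M]
  [Module k M]

theorem eq_zero_of_sliceLeft_eq_zero {z : V ⊗[k] M} (h : ∀ φ, sliceLeft φ z = 0) : z = 0 := by
  refine (TensorProduct.equivFinsuppOfBasisLeft (Module.Free.chooseBasis k V)).map_eq_zero_iff.1
    (Finsupp.ext fun i => ?_)
  rw [TensorProduct.equivFinsuppOfBasisLeft_apply]
  exact h _

theorem eq_zero_of_sliceRight_eq_zero {z : M ⊗[k] V} (h : ∀ φ, sliceRight φ z = 0) : z = 0 := by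
  refine (TensorProduct.equivFinsuppOfBasisRight (Module.Free.chooseBasis k V)).map_eq_zero_iff.1
    (Finsupp.ext fun i => ?_)
  rw [TensorProduct.equivFinsuppOfBasisRight_apply]
  exact h _

theorem mem_range_rTensor_subtype {A : Submodule k M} {z : M ⊗[k] V}
    (h : ∀ φ, sliceRight φ z ∈ A) : z ∈ LinearMap.range (A.subtype.rTensor V) := by
  refine (rTensor_exact V (LinearMap.exact_subtype_mkQ A) A.mkQ_surjective z).1
    (eq_zero_of_sliceRight_eq_zero fun φ => ?_)
  rw [sliceRight_rTensor]
  exact (Submodule.Quotient.mk_eq_zero A).2 (h φ)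

theorem mem_range_lTensor_subtype {A : Submodule k M} {z : V ⊗[k] M}
    (h : ∀ φ, sliceLeft φ z ∈ A) : z ∈ LinearMap.range (A.subtype.lTensor V) := by
  refine (lTensor_exact V (LinearMap.exact_subtype_mkQ A) A.mkQ_surjective z).1
    (eq_zero_of_sliceLeft_eq_zero fun φ => ?_)
  rw [sliceLeft_lTensor]
  exact (Submodule.Quotient.mk_eq_zero A).2 (h φ)

theorem mem_range_mapIncl {A : Submodule k M} {z : M ⊗[k] M} (h_left : ∀ φ, sliceLeft φ z ∈ A)
    (h_right : ∀ φ, sliceRight φ z ∈ A) : z ∈ LinearMap.range (TensorProduct.mapIncl A A) := by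
  obtain ⟨y, rfl⟩ := mem_range_rTensor_subtype h_right
  obtain ⟨w, rfl⟩ : y ∈ LinearMap.range (A.subtype.lTensor A) := by
    refine mem_range_lTensor_subtype fun φ => ?_
    obtain ⟨ψ, rfl⟩ := LinearMap.exists_extend φ
    convert! h_left ψ using 1
    suffices h : sliceLeft (ψ ∘ₗ A.subtype) = sliceLeft ψ ∘ₗ A.subtype.rTensor M from
      LinearMap.congr_fun h y
    ext; simp
  exact ⟨w, (LinearMap.congr_fun (LinearMap.rTensor_comp_lTensor ..) w).symm⟩

instance finiteDimensional_range_flip_sliceRight (z : M ⊗[k] V) :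
    FiniteDimensional k (LinearMap.range (sliceRight.flip z)) := by
  obtain ⟨F, _, hF⟩ := TensorProduct.exists_finite_submodule_left_of_setFinite {z}
    (Set.finite_singleton z)
  obtain ⟨y, rfl⟩ := hF rfl
  refine Submodule.finiteDimensional_of_le (S₂ := F) ?_
  rintro _ ⟨φ, rfl⟩
  rw [LinearMap.flip_apply, sliceRight_rTensor]
  exact (sliceRight φ y).2

theorem exists_dual_family {ι : Type*} [DecidableEq ι] {v : ι → M} (hv : LinearIndependent k v) :
    ∃ φ : ι → Module.Dual k M, ∀ i j, φ i (v j) = if j = i then 1 else 0 := by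
  obtain ⟨p, hp⟩ := LinearMap.exists_leftInverse_of_injective _ (LinearMap.ker_eq_bot.2 hv)
  refine ⟨fun i => Finsupp.lapply i ∘ₗ p, fun i j => ?_⟩
  have h : p (v j) = Finsupp.single j 1 := by
    simpa using LinearMap.congr_fun hp (Finsupp.single j 1)
  rw [LinearMap.comp_apply, h, Finsupp.lapply_apply, Finsupp.single_apply]

theorem eq_zero_of_sum_tmul_eq_zero {ι : Type*} [Fintype ι] {v : ι → V}
    (hv : LinearIndependent k v) {m : ι → M} (h : ∑ i, v i ⊗ₜ[k] m i = 0) (i : ι) : m i = 0 := by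
  classical
  obtain ⟨φ, hφ⟩ := exists_dual_family hv
  simpa [hφ] using congrArg (sliceLeft (φ i)) h

end FieldSlices

section SemiInvariants

variable {k X : Type u} [CommRing k] [CommRing X] [HopfAlgebra k X]

theorem mapPoint_includeLeft_mul_mapPoint_includeRight_apply {R S : Type*} [CommRing R]
    [Algebra k R] [CommRing S] [Algebra k S] (g : Points k X R) (n : Points k X S) (x : X) :
    (mapPoint (includeLeft : R →ₐ[k] R ⊗[k] S) g *
      mapPoint (includeRight : S →ₐ[k] R ⊗[k] S) n) x =
        map g.ofConv n.ofConv (Coalgebra.comul (R := k) x) := by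
  rw [points_mul_apply, map_eq_productMap]
  rfl

theorem sliceLeft_mul_includeRight {V R : Type*} [CommRing V] [Algebra k V] [CommRing R]
    [Algebra k R] (φ : Module.Dual k V) (z : V ⊗[k] R) (r : R) :
    sliceLeft φ (z * includeRight r) = sliceLeft φ z * r := by
  suffices h : sliceLeft φ ∘ₗ LinearMap.mulRight k (includeRight r : V ⊗[k] R) =
      LinearMap.mulRight k r ∘ₗ sliceLeft φ from LinearMap.congr_fun h z
  ext; simp

theorem counit_sliceLeft_comul (φ : Module.Dual k X) (x : X) :
    Coalgebra.counit (R := k) (sliceLeft φ (Coalgebra.comul x)) = φ x := by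
  rw [← sliceLeft_lTensor, Coalgebra.lTensor_counit_comul, sliceLeft_tmul, smul_eq_mul, mul_one]

variable (k) in
/-- The function `f` has weight `χ` under right translation by the closed subscheme cut out
by `I`, that is, `f(gn) = f(g) χ(n)`. -/
def IsSemiInvariant (I : Ideal X) (χ f : X) : Prop :=
  ∀ (R : Type u) [CommRing R] [Algebra k R] (g n : Points k X R), VanishesOn I n →
    (g * n) f = g f * n χ

variable {I : Ideal X} {χ η f h : X}

theorem IsSemiInvariant.mul (hf : IsSemiInvariant k I χ f) (hh : IsSemiInvariant k I η h) :
    IsSemiInvariant k I (χ * η) (f * h) := fun R _ _ g n hn => by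
  rw [map_mul, map_mul, map_mul, hf R g n hn, hh R g n hn, mul_mul_mul_comm]

theorem IsSemiInvariant.sliceLeft_comul (hf : IsSemiInvariant k I χ f) (φ : Module.Dual k X) :
    IsSemiInvariant k I χ (sliceLeft φ (Coalgebra.comul f)) := by
  intro R _ _ g n hn
  let ι : R →ₐ[k] X ⊗[k] R := includeRight
  let γ : Points k X (X ⊗[k] R) := mapPoint includeLeft (toConv (AlgHom.id k X))
  have h_slice (g : Points k X R) :
      sliceLeft φ ((γ * mapPoint ι g) f) = g (sliceLeft φ (Coalgebra.comul f)) := by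
    rw [mapPoint_includeLeft_mul_mapPoint_includeRight_apply]
    exact sliceLeft_lTensor φ g.ofConv.toLinearMap _
  rw [← h_slice, ← h_slice, map_mul, ← mul_assoc, hf _ _ _ (hn.mapPoint ι), mapPoint_apply,
    sliceLeft_mul_includeRight]

variable (k) in
/-- The functions invariant under right translation by the closed subscheme cut out by `I`, that
is, the functions on the quotient. -/
def coinvariants (I : Ideal X) : Subalgebra k X where
  carrier := {x | IsSemiInvariant k I 1 x}
  mul_mem' hx hy := mul_one (1 : X) ▸ IsSemiInvariant.mul hx hy
  add_mem' hx hy R _ _ g n hn := by rw [map_add, map_add, hx R g n hn, hy R g n hn, add_mul]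
  algebraMap_mem' r R _ _ g n _ := by rw [AlgHom.commutes, AlgHom.commutes, map_one, mul_one]

theorem mem_coinvariants_iff {x : X} :
    x ∈ coinvariants k I ↔ ∀ (R : Type u) [CommRing R] [Algebra k R] (g n : Points k X R),
      VanishesOn I n → (g * n) x = g x :=
  forall₃_congr fun R _ _ => forall₃_congr fun g n _ => by rw [map_one, mul_one]

theorem sliceRight_comul_mem_coinvariants (hI : IsConjStable k I) {x : X}
    (hx : x ∈ coinvariants k I) (φ : Module.Dual k X) :
    sliceRight φ (Coalgebra.comul x) ∈ coinvariants k I := by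
  rw [mem_coinvariants_iff] at hx ⊢
  intro R _ _ g n hn
  let ι : R →ₐ[k] R ⊗[k] X := includeLeft
  let γ : Points k X (R ⊗[k] X) := mapPoint includeRight (toConv (AlgHom.id k X))
  have h_slice (g : Points k X R) :
      sliceRight φ ((mapPoint ι g * γ) x) = g (sliceRight φ (Coalgebra.comul x)) := by
    rw [mapPoint_includeLeft_mul_mapPoint_includeRight_apply]
    exact sliceRight_rTensor φ g.ofConv.toLinearMap _
  have h_conj := hI _ γ⁻¹ _ (hn.mapPoint ι)
  rw [← h_slice, ← h_slice, ← hx _ (mapPoint ι g * γ) _ h_conj, map_mul]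
  congr 2
  group

theorem mk_eq_algebraMap_counit {A : Subalgebra k X} {y : X} (hy : y ∈ A) :
    Ideal.Quotient.mk (Ideal.map A.val (augmentationIdeal A)) y =
      algebraMap k _ (Coalgebra.counit y) := by
  refine Ideal.Quotient.eq.2 (Ideal.mem_map_of_mem A.val
    (x := (⟨y, hy⟩ : A) - algebraMap k A (Coalgebra.counit y)) ?_)
  change Bialgebra.counitAlgHom k X (y - algebraMap k X (Coalgebra.counit y)) = 0
  simp

theorem map_augmentationIdeal_coinvariants_le :
    Ideal.map (coinvariants k I).val (augmentationIdeal (coinvariants k I)) ≤ I := by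
  rw [Ideal.map_le_iff_le_comap]
  rintro ⟨x, hx⟩ (h_counit : Coalgebra.counit (R := k) x = 0)
  have h := mem_coinvariants_iff.1 hx _ 1 (quotientPoint k I) (vanishesOn_quotientPoint I)
  rw [one_mul, points_one_apply, h_counit, map_zero] at h
  exact (Ideal.Quotient.eq_zero_iff_mem (I := I)).1 h

end SemiInvariants

theorem isHopfSubalgebra_coinvariants {k X : Type u} [Field k] [CommRing X] [HopfAlgebra k X]
    {I : Ideal X} [I.IsHopfIdeal k] (hI : IsConjStable k I) :
    IsHopfSubalgebra (coinvariants k I) where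
  comul_mem _ hx := mem_range_mapIncl (IsSemiInvariant.sliceLeft_comul hx)
    (sliceRight_comul_mem_coinvariants hI hx)
  antipode_mem x hx := by
    rw [mem_coinvariants_iff] at hx ⊢
    intro R _ _ g n hn
    rw [← points_inv_apply, ← points_inv_apply, ← hx R g⁻¹ (g * n⁻¹ * g⁻¹) (hI R g _ hn.inv)]
    congr 2
    group

/-- The prime `ker ε` is minimal in the Artinian ring `B`, hence an associated prime of `B`. -/
theorem exists_ne_zero_forall_mul_eq_smul {k B : Type*} [Field k] [CommRing B] [Algebra k B]
    [FiniteDimensional k B] (ε : B →ₐ[k] k) : ∃ s : B, s ≠ 0 ∧ ∀ b, s * b = ε b • s := by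
  have : IsArtinianRing B := IsArtinianRing.of_finite k B
  have h_max : (RingHom.ker ε).IsMaximal :=
    RingHom.ker_isMaximal_of_surjective ε fun r => ⟨algebraMap k B r, ε.commutes r⟩
  have h_min : RingHom.ker ε ∈ (Module.annihilator B B).minimalPrimes := by
    rw [Module.annihilator_eq_bot.2 inferInstance]
    refine ⟨⟨h_max.isPrime, bot_le⟩, fun J ⟨hJ, _⟩ hle => ?_⟩
    exact ((IsArtinianRing.isMaximal_of_isPrime J).eq_of_le h_max.ne_top hle).ge
  obtain ⟨-, s, hs⟩ := Submodule.isAssociatedPrime_iff.1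
    (Module.associatedPrimes.minimalPrimes_annihilator_subset_associatedPrimes B B h_min)
  have h_ker (b : B) : ε b = 0 ↔ b * s = 0 := by
    rw [← RingHom.mem_ker, hs, Submodule.mem_colon_singleton, Submodule.mem_bot, smul_eq_mul]
  refine ⟨s, ?_, fun b => ?_⟩
  · rintro rfl
    exact one_ne_zero ((map_one ε).symm.trans ((h_ker 1).2 (mul_zero 1)))
  · have h := (h_ker (b - algebraMap k B (ε b))).1 (by simp)
    rwa [sub_mul, sub_eq_zero, ← Algebra.smul_def, mul_comm] at h

section ConjElement

variable {k X R : Type u} [CommRing k] [CommRing X] [HopfAlgebra k X] [CommRing R] [Algebra k R]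
  {I : Ideal X} {c : X}

theorem sliceRight_mul_sliceRight {M A B : Type*} [CommRing M] [Algebra k M] [CommRing A]
    [Algebra k A] [CommRing B] [Algebra k B] (φ : Module.Dual k A) (ψ : Module.Dual k B)
    (u : M ⊗[k] A) (v : M ⊗[k] B) :
    sliceRight φ u * sliceRight ψ v = sliceRight (TensorProduct.dualDistrib k A B (φ ⊗ₜ ψ))
      (map (.id k M) includeLeft u * map (.id k M) includeRight v) := by
  induction u with
  | zero => simp
  | add u u' hu hu' => simp only [map_add, add_mul, hu, hu']
  | tmul m a =>
    induction v with
    | zero => simp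
    | add v v' hv hv' => simp only [map_add, mul_add, hv, hv']
    | tmul m' b => simp [smul_smul, mul_comm]

theorem sliceRight_includeLeft_mul {M A : Type*} [CommRing M] [Algebra k M] [CommRing A]
    [Algebra k A] (φ : Module.Dual k A) (m : M) (z : M ⊗[k] A) :
    sliceRight φ (includeLeft (S := k) m * z) = m * sliceRight φ z := by
  suffices h : sliceRight φ ∘ₗ LinearMap.mulLeft k (includeLeft (S := k) m : M ⊗[k] A) =
      LinearMap.mulLeft k m ∘ₗ sliceRight φ from LinearMap.congr_fun h z
  ext; simp

variable (k) in
/-- The function `(g, n) ↦ c(g n g⁻¹)` of a point `g` of `X` and a point `n` of `X ⧸ I`. -/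
noncomputable def conjElement (I : Ideal X) (c : X) : X ⊗[k] (X ⧸ I) :=
  map (.id k X) (Ideal.Quotient.mkₐ k I) (coadjoint k X c)

theorem productMap_conjElement (g : Points k X R) (h : X ⧸ I →ₐ[k] R) (c : X) :
    productMap g.ofConv h (conjElement k I c) =
      (g * mapPoint h (quotientPoint k I) * g⁻¹) c := by
  rw [conj_apply, conjElement, ← AlgHom.comp_apply, productMap_comp_map, AlgHom.comp_id]
  rfl

variable (R) in
/-- The generic point of the closed subscheme cut out by `I`, over `R ⊗ X ⧸ I`. -/
noncomputable def genericPoint (I : Ideal X) : Points k X (R ⊗[k] (X ⧸ I)) :=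
  mapPoint includeRight (quotientPoint k I)

theorem vanishesOn_genericPoint : VanishesOn I (genericPoint R I : Points k X _) :=
  (vanishesOn_quotientPoint I).mapPoint _

theorem map_conjElement {S : Type u} [CommRing S] [Algebra k S] (g : Points k X R)
    (h : X ⧸ I →ₐ[k] S) (c : X) :
    map g.ofConv h (conjElement k I c) =
      (mapPoint includeLeft g * mapPoint (includeRight.comp h) (quotientPoint k I) *
        (mapPoint includeLeft g)⁻¹ : Points k X (R ⊗[k] S)) c := by
  rw [map_eq_productMap]
  exact productMap_conjElement _ _ c

theorem point_sliceRight_conjElement (g : Points k X R) (φ : Module.Dual k (X ⧸ I)) (c : X) :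
    g (sliceRight φ (conjElement k I c)) = sliceRight φ
      ((mapPoint includeLeft g * genericPoint R I * (mapPoint includeLeft g)⁻¹ :
        Points k X (R ⊗[k] (X ⧸ I))) c) :=
  (sliceRight_rTensor φ g.ofConv.toLinearMap _).symm.trans
    (congrArg (sliceRight φ) (map_conjElement g (.id k (X ⧸ I)) c))

theorem counit_sliceRight_conjElement (φ : Module.Dual k (X ⧸ I)) (c : X) :
    Coalgebra.counit (R := k) (sliceRight φ (conjElement k I c)) =
      φ (Ideal.Quotient.mk I c) := by
  refine (point_sliceRight_conjElement (1 : Points k X k) φ c).trans ?_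
  rw [map_one, one_mul, inv_one, mul_one]
  exact (sliceRight_tmul _ _ _).trans (mul_one _)

end ConjElement

section Character

variable {k X R : Type u} [CommRing k] [CommRing X] [HopfAlgebra k X] [CommRing R] [Algebra k R]
  {I : Ideal X} {c : X}

theorem IsSemiInvariant.conj_mul_apply (hc : IsSemiInvariant k I c c) (hI : IsConjStable k I)
    (g : Points k X R) {n m : Points k X R} (hm : VanishesOn I m) :
    (g * (n * m) * g⁻¹) c = (g * n * g⁻¹) c * (g * m * g⁻¹) c := by
  rw [← hc R _ _ (hI R g m hm)]
  congr 2
  group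

variable [I.IsHopfIdeal k]

theorem IsSemiInvariant.mul_inv_apply (hc : IsSemiInvariant k I c c)
    (hc_one : Coalgebra.counit (R := k) c = 1) {n : Points k X R} (hn : VanishesOn I n) :
    n c * n⁻¹ c = 1 := by
  rw [← hc R n n⁻¹ hn.inv, mul_inv_cancel, points_one_apply, hc_one, map_one]

theorem IsSemiInvariant.conj_apply (hc : IsSemiInvariant k I c c)
    (hc_one : Coalgebra.counit (R := k) c = 1) {m n : Points k X R} (hm : VanishesOn I m)
    (hn : VanishesOn I n) : (m * n * m⁻¹) c = n c := by
  rw [hc R _ _ hm.inv, hc R _ _ hn, mul_right_comm, hc.mul_inv_apply hc_one hm, one_mul]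

theorem sliceRight_conjElement_mem_coinvariants (hI : IsConjStable k I)
    (hc : IsSemiInvariant k I c c) (hc_one : Coalgebra.counit (R := k) c = 1)
    (φ : Module.Dual k (X ⧸ I)) : sliceRight φ (conjElement k I c) ∈ coinvariants k I := by
  refine mem_coinvariants_iff.2 fun R _ _ g n hn => ?_
  let ι : R →ₐ[k] R ⊗[k] (X ⧸ I) := includeLeft
  rw [point_sliceRight_conjElement, point_sliceRight_conjElement,
    ← hc.conj_apply hc_one (hI _ (mapPoint ι g) _ (hn.mapPoint ι))
      (hI _ (mapPoint ι g) _ vanishesOn_genericPoint), map_mul]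
  change sliceRight φ ((mapPoint ι g * mapPoint ι n * genericPoint R I *
    (mapPoint ι g * mapPoint ι n)⁻¹ : Points k X (R ⊗[k] (X ⧸ I))) c) = _
  congr 2
  group

theorem mapPoint_comul_quotientPoint :
    mapPoint (Bialgebra.comulAlgHom k (X ⧸ I)) (quotientPoint k I) =
      mapPoint includeLeft (quotientPoint k I) * mapPoint includeRight (quotientPoint k I) :=
  points_ext fun x =>
    (mapPoint_includeLeft_mul_mapPoint_includeRight_apply (quotientPoint k I) _ x).symm

theorem lTensor_comul_conjElement (hI : IsConjStable k I) (hc : IsSemiInvariant k I c c) :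
    (Coalgebra.comul (R := k)).lTensor X (conjElement k I c) =
      map (.id k X) includeLeft (conjElement k I c) *
        map (.id k X) includeRight (conjElement k I c) := by
  have h_comul := map_conjElement (I := I) (toConv (.id k X)) (Bialgebra.comulAlgHom k (X ⧸ I)) c
  rw [mapPoint_comp, mapPoint_comul_quotientPoint, map_mul,
    hc.conj_mul_apply hI _ (((vanishesOn_quotientPoint I).mapPoint _).mapPoint _)] at h_comul
  rw [← mapPoint_comp, ← mapPoint_comp, ← map_conjElement, ← map_conjElement] at h_comul
  exact h_comul

theorem sliceRight_counit_conjElement (hc_one : Coalgebra.counit (R := k) c = 1) :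
    sliceRight Coalgebra.counit (conjElement k I c) = 1 := by
  have h_slice : sliceRight (Coalgebra.counit (R := k) (A := X ⧸ I)) =
      (productMap (.id k X) ((Algebra.ofId k X).comp
        (Bialgebra.counitAlgHom k (X ⧸ I)))).toLinearMap :=
    TensorProduct.ext' fun x y => (Algebra.smul_def _ _).trans (mul_comm _ _)
  have h_one : mapPoint ((Algebra.ofId k X).comp (Bialgebra.counitAlgHom k (X ⧸ I)))
      (quotientPoint k I) = 1 := rfl
  refine (LinearMap.congr_fun h_slice _).trans
    ((productMap_conjElement (toConv (.id k X)) _ c).trans ?_)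
  rw [h_one, mul_one, mul_inv_cancel, points_one_apply, hc_one, map_one]

variable (k I c) in
/-- The functions `g ↦ φ(n ↦ c(g n g⁻¹))` on `X`, for linear forms `φ` on `X ⧸ I`. They form a
subalgebra because `c` restricts to a character of the closed subgroup cut out by `I`. -/
noncomputable def conjSubalgebra (hI : IsConjStable k I) (hc : IsSemiInvariant k I c c)
    (hc_one : Coalgebra.counit (R := k) c = 1) : Subalgebra k X :=
  (LinearMap.range (sliceRight.flip (conjElement k I c))).toSubalgebra
    ⟨Coalgebra.counit, sliceRight_counit_conjElement hc_one⟩ (by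
      rintro _ _ ⟨φ, rfl⟩ ⟨ψ, rfl⟩
      refine ⟨TensorProduct.dualDistrib k _ _ (φ ⊗ₜ ψ) ∘ₗ Coalgebra.comul, ?_⟩
      simp only [LinearMap.flip_apply, sliceRight_mul_sliceRight,
        ← lTensor_comul_conjElement hI hc, sliceRight_lTensor])

theorem isSemiInvariant_mul_antipode (hI : IsConjStable k I) {s b : X} (hs : s ∈ coinvariants k I)
    (h_eigen : ∀ (R : Type u) [CommRing R] [Algebra k R] (g n : Points k X R),
      VanishesOn I n → g s * (g * n * g⁻¹) c = g s * n c) (hb : IsSemiInvariant k I c b) :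
    IsSemiInvariant k I (HopfAlgebra.antipode k c) (s * HopfAlgebra.antipode k b) := by
  intro R _ _ g n hn
  have hb_inv : (g * n)⁻¹ b = g⁻¹ b * (g * n⁻¹ * g⁻¹) c := by
    rw [← hb R g⁻¹ _ (hI R g _ hn.inv)]
    congr 2
    group
  rw [map_mul, map_mul, ← points_inv_apply, ← points_inv_apply, ← points_inv_apply,
    mem_coinvariants_iff.1 hs R g n hn, hb_inv, mul_left_comm, h_eigen R g _ hn.inv]
  ring

end Character

section CharacterInverse

variable {k X : Type u} [Field k] [CommRing X] [HopfAlgebra k X] {I : Ideal X} {c : X}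

theorem exists_mul_antipode_sliceLeft_ne_zero (hc_one : Coalgebra.counit (R := k) c = 1) {s : X}
    (hs : s ≠ 0) :
    ∃ φ, s * HopfAlgebra.antipode k (sliceLeft φ (Coalgebra.comul (R := k) c)) ≠ 0 := by
  by_contra! h
  have h_zero : (LinearMap.mulLeft k s ∘ₗ HopfAlgebra.antipode k).lTensor X
      (Coalgebra.comul (R := k) c) = 0 :=
    eq_zero_of_sliceLeft_eq_zero fun φ => (sliceLeft_lTensor _ _ _).trans (h φ)
  have h_mul : LinearMap.mul' k X ∘ₗ (LinearMap.mulLeft k s ∘ₗ HopfAlgebra.antipode k).lTensor X =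
      LinearMap.mulLeft k s ∘ₗ LinearMap.mul' k X ∘ₗ (HopfAlgebra.antipode k).lTensor X :=
    TensorProduct.ext' fun a b => mul_left_comm _ _ _
  have h := LinearMap.congr_fun h_mul (Coalgebra.comul c)
  simp only [LinearMap.comp_apply, h_zero, HopfAlgebra.mul_antipode_lTensor_comul_apply, hc_one,
    map_one, map_zero, LinearMap.mulLeft_apply, mul_one] at h
  exact hs h.symm

variable [I.IsHopfIdeal k]

theorem exists_conj_eigenvector (hI : IsConjStable k I) (hc : IsSemiInvariant k I c c)
    (hc_one : Coalgebra.counit (R := k) c = 1) :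
    ∃ s ∈ coinvariants k I, s ≠ 0 ∧ ∀ (R : Type u) [CommRing R] [Algebra k R]
      (g n : Points k X R), VanishesOn I n → g s * (g * n * g⁻¹) c = g s * n c := by
  let B := conjSubalgebra k I c hI hc hc_one
  have : FiniteDimensional k B := finiteDimensional_range_flip_sliceRight (conjElement k I c)
  obtain ⟨⟨s, hs⟩, hs_ne, h_eigen⟩ :=
    exists_ne_zero_forall_mul_eq_smul ((Bialgebra.counitAlgHom k X).comp B.val)
  have h_tmul : includeLeft (S := k) s * conjElement k I c = s ⊗ₜ[k] Ideal.Quotient.mk I c := by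
    refine sub_eq_zero.1 (eq_zero_of_sliceRight_eq_zero fun φ => ?_)
    have h := congrArg B.val (h_eigen ⟨_, φ, rfl⟩)
    simp only [map_mul, map_smul, Subalgebra.coe_val, AlgHom.comp_apply,
      Bialgebra.counitAlgHom_apply, LinearMap.flip_apply, counit_sliceRight_conjElement] at h
    rw [map_sub, sliceRight_includeLeft_mul, h, sliceRight_tmul, sub_self]
  refine ⟨s, ?_, fun h => hs_ne (Subtype.ext h), fun R _ _ g n hn => ?_⟩
  · obtain ⟨φ, rfl⟩ := hs
    exact sliceRight_conjElement_mem_coinvariants hI hc hc_one φ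
  · have h := congrArg (productMap g.ofConv hn.lift) h_tmul
    rwa [map_mul, productMap_conjElement, includeLeft_apply, productMap_left_apply,
      productMap_apply_tmul] at h

theorem exists_isSemiInvariant_antipode (hI : IsConjStable k I) (hc : IsSemiInvariant k I c c)
    (hc_one : Coalgebra.counit (R := k) c = 1) :
    ∃ d, IsSemiInvariant k I (HopfAlgebra.antipode k c) d ∧ Coalgebra.counit (R := k) d = 1 := by
  obtain ⟨s, hs, hs_ne, h_eigen⟩ := exists_conj_eigenvector hI hc hc_one
  obtain ⟨φ, hφ⟩ := exists_mul_antipode_sliceLeft_ne_zero hc_one hs_ne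
  obtain ⟨ψ, hψ⟩ := Module.Projective.exists_dual_eq_one k hφ
  have h_semi := isSemiInvariant_mul_antipode hI hs h_eigen (hc.sliceLeft_comul φ)
  exact ⟨_, h_semi.sliceLeft_comul ψ, by rw [counit_sliceLeft_comul, hψ]⟩

end CharacterInverse

section MultiplicativeMatrix

variable {k X : Type u} [CommRing k] [CommRing X] [HopfAlgebra k X] {I : Ideal X}

theorem comul_sliceRight_comul (φ : Module.Dual k X) (x : X) :
    Coalgebra.comul (R := k) (sliceRight φ (Coalgebra.comul x)) =
      (sliceRight φ ∘ₗ Coalgebra.comul).lTensor X (Coalgebra.comul (R := k) x) := by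
  have h_assoc : sliceRight φ ∘ₗ (TensorProduct.assoc k X X X).symm.toLinearMap =
      (sliceRight φ).lTensor X := by
    ext; simp
  rw [← sliceRight_rTensor, ← Coalgebra.coassoc_symm_apply, LinearMap.lTensor_comp_apply]
  exact LinearMap.congr_fun h_assoc _

theorem sliceRight_counit_comul (x : X) :
    sliceRight Coalgebra.counit (Coalgebra.comul (R := k) x) = x :=
  (congrArg (TensorProduct.rid k X) (Coalgebra.lTensor_counit_comul x)).trans (one_smul k x)

variable (k) in
/-- A multiplicative matrix is the matrix of coefficients of a comodule with a given basis, that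
is, of a representation of the group scheme represented by `X`. -/
structure IsMultiplicativeMatrix {ι : Type*} [Fintype ι] [DecidableEq ι] (a : Matrix ι ι X) :
    Prop where
  comul_apply : ∀ i j, Coalgebra.comul (R := k) (a i j) = ∑ l, a i l ⊗ₜ a l j
  counit_apply : ∀ i j, Coalgebra.counit (R := k) (a i j) = (1 : Matrix ι ι k) i j

variable {ι κ : Type*} [Fintype ι] [DecidableEq ι]

namespace IsMultiplicativeMatrix

section Basic

variable {a : Matrix ι ι X} (ha : IsMultiplicativeMatrix k a)

include ha

theorem points_mul_apply {R : Type*} [CommRing R] [Algebra k R] (g n : Points k X R) (i j : ι) :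
    (g * n) (a i j) = ∑ l, g (a i l) * n (a l j) := by
  rw [CommHopf.points_mul_apply, ha.comul_apply, map_sum]
  rfl

theorem counit_det_submatrix [Fintype κ] [DecidableEq κ] (ρ σ : κ → ι) :
    Coalgebra.counit (R := k) (a.submatrix ρ σ).det = ((1 : Matrix ι ι k).submatrix ρ σ).det :=
  (AlgHom.map_det (Bialgebra.counitAlgHom k X) _).trans
    (congrArg Matrix.det (Matrix.ext fun i j => ha.counit_apply (ρ i) (σ j)))

end Basic

variable [Fintype κ] [DecidableEq κ] {a : Matrix (ι ⊕ κ) (ι ⊕ κ) X}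
  (ha : IsMultiplicativeMatrix k a)

include ha

theorem counit_det_submatrix_inl :
    Coalgebra.counit (R := k) (a.submatrix .inl .inl : Matrix ι ι X).det = 1 := by
  rw [ha.counit_det_submatrix, Matrix.submatrix_one _ Sum.inl_injective, Matrix.det_one]

theorem counit_det_submatrix_update (m : ι) (i : κ) : Coalgebra.counit (R := k)
    (a.submatrix (Function.update .inl m (.inr i)) .inl : Matrix ι ι X).det = 0 := by
  rw [ha.counit_det_submatrix]
  exact Matrix.det_eq_zero_of_row_eq_zero m fun j => by simp

theorem isSemiInvariant_minor (h_mem : ∀ i j, a (.inr i) (.inl j) ∈ I) (ρ : ι → ι ⊕ κ) :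
    IsSemiInvariant k I (a.submatrix .inl .inl : Matrix ι ι X).det
      (a.submatrix ρ .inl).det := by
  intro R _ _ g n hn
  rw [AlgHom.map_det, AlgHom.map_det, AlgHom.map_det, ← Matrix.det_mul]
  refine congrArg Matrix.det (Matrix.ext fun i j => ?_)
  refine (ha.points_mul_apply g n (ρ i) (.inl j)).trans ?_
  rw [Fintype.sum_sum_type, Finset.sum_eq_zero (s := Finset.univ (α := κ)), add_zero]
  · rfl
  · exact fun l _ => by rw [hn _ (h_mem l j), mul_zero]

end IsMultiplicativeMatrix

theorem eq_zero_of_forall_det_updateRow_eq_zero {Q : Type*} [CommRing Q] {P : Matrix ι ι Q}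
    (hP : IsUnit P.det) {v : ι → Q} (h : ∀ m, (P.updateRow m v).det = 0) : v = 0 := by
  have h_cramer : P.transpose.cramer v = 0 :=
    funext fun m => (Matrix.cramer_transpose_apply P v m).trans (h m)
  have h_smul := Matrix.mulVec_cramer P.transpose v
  rw [h_cramer, Matrix.mulVec_zero, Matrix.det_transpose] at h_smul
  exact hP.smul_eq_zero.1 h_smul.symm

end MultiplicativeMatrix

section FieldMultiplicativeMatrix

variable {k X : Type u} [Field k] [CommRing X] [HopfAlgebra k X] {I : Ideal X} {ι κ : Type*}
  [Fintype ι] [DecidableEq ι] [Fintype κ] [DecidableEq κ]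

theorem isMultiplicativeMatrix_of_comul_eq {e : ι → X} {a : Matrix ι ι X}
    (he : LinearIndependent k e)
    (h_comul : ∀ j, Coalgebra.comul (R := k) (e j) = ∑ i, e i ⊗ₜ a i j) :
    IsMultiplicativeMatrix k a where
  comul_apply i j := by
    have h := Coalgebra.coassoc_apply (R := k) (e j)
    simp only [h_comul, map_sum, LinearMap.rTensor_tmul, LinearMap.lTensor_tmul,
      TensorProduct.sum_tmul, TensorProduct.assoc_tmul] at h
    rw [Finset.sum_comm, eq_comm, ← sub_eq_zero, ← Finset.sum_sub_distrib] at h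
    simp only [← TensorProduct.tmul_sum, ← TensorProduct.tmul_sub] at h
    exact sub_eq_zero.1 (eq_zero_of_sum_tmul_eq_zero he h i)
  counit_apply i j := by
    obtain ⟨φ, hφ⟩ := exists_dual_family he
    simpa [h_comul, hφ, Matrix.one_apply, eq_comm] using
      congrArg (φ i) (sliceRight_counit_comul (k := k) (e j))

/-- Multiplying the minors, which are semi-invariant of the same weight, by a semi-invariant of
the inverse weight makes them functions on the quotient. -/
theorem IsMultiplicativeMatrix.exists_mk_minor_mul_eq [I.IsHopfIdeal k]
    {a : Matrix (ι ⊕ κ) (ι ⊕ κ) X} (ha : IsMultiplicativeMatrix k a) (hI : IsConjStable k I)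
    (h_mem : ∀ i j, a (.inr i) (.inl j) ∈ I) :
    ∃ δ, ∀ ρ : ι → ι ⊕ κ, Ideal.Quotient.mk
      (Ideal.map (coinvariants k I).val (augmentationIdeal (coinvariants k I)))
        (a.submatrix ρ .inl).det * δ =
      algebraMap k _ (Coalgebra.counit (a.submatrix ρ .inl).det) := by
  have hc := ha.isSemiInvariant_minor h_mem .inl
  obtain ⟨d, hd, hd_one⟩ := exists_isSemiInvariant_antipode hI hc ha.counit_det_submatrix_inl
  refine ⟨Ideal.Quotient.mk _ d, fun ρ => ?_⟩
  rw [← map_mul, mk_eq_algebraMap_counit, Bialgebra.counit_mul, hd_one, mul_one]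
  refine mem_coinvariants_iff.2 fun R _ _ g n hn => ?_
  rw [(ha.isSemiInvariant_minor h_mem ρ).mul hd R g n hn, map_mul, map_mul, ← points_inv_apply,
    hc.mul_inv_apply ha.counit_det_submatrix_inl hn, mul_one]

theorem IsMultiplicativeMatrix.inr_inl_mem_map [I.IsHopfIdeal k]
    {a : Matrix (ι ⊕ κ) (ι ⊕ κ) X} (ha : IsMultiplicativeMatrix k a) (hI : IsConjStable k I)
    (h_mem : ∀ i j, a (.inr i) (.inl j) ∈ I) (i : κ) (j : ι) :
    a (.inr i) (.inl j) ∈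
      Ideal.map (coinvariants k I).val (augmentationIdeal (coinvariants k I)) := by
  obtain ⟨δ, hδ⟩ := ha.exists_mk_minor_mul_eq hI h_mem
  let q := Ideal.Quotient.mk
    (Ideal.map (coinvariants k I).val (augmentationIdeal (coinvariants k I)))
  let P : Matrix ι ι X := a.submatrix .inl .inl
  have h_one : q P.det * δ = 1 := by rw [hδ, ha.counit_det_submatrix_inl, map_one]
  have h_zero (m : ι) : q (a.submatrix (Function.update .inl m (.inr i)) .inl).det = 0 := by
    have h := hδ (Function.update .inl m (.inr i))
    rw [ha.counit_det_submatrix_update, map_zero] at h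
    rw [← mul_one (q _), ← h_one, mul_left_comm, h, mul_zero]
  have h_row : (fun l => q (a (.inr i) (.inl l))) = 0 := by
    refine eq_zero_of_forall_det_updateRow_eq_zero (P := P.map q) ?_ fun m => ?_
    · exact .of_mul_eq_one δ ((congrArg (· * δ) (RingHom.map_det q P).symm).trans h_one)
    · rw [← h_zero m, RingHom.map_det]
      congr 1
      ext l j
      obtain rfl | hl := eq_or_ne l m <;> simp [P, *]
  exact Ideal.Quotient.eq_zero_iff_mem.1 (congrFun h_row j)

end FieldMultiplicativeMatrix

theorem exists_adapted_basis {k M : Type*} [Field k] [AddCommGroup M] [Module k M]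
    (V U : Submodule k M) [FiniteDimensional k V] :
    ∃ (p q : ℕ) (b : Module.Basis (Fin p ⊕ Fin q) k V), (∀ i, (b (.inl i) : M) ∈ U) ∧
      (LinearIndependent k fun i => U.mkQ (b (.inr i))) ∧
      V ⊓ U ≤ Submodule.span k (Set.range fun i => (b (.inl i) : M)) := by
  let bW := Module.finBasis k (U.comap V.subtype)
  let bQ := Module.finBasis k (V ⧸ U.comap V.subtype)
  have h_inl (i) : bW.sumQuot bQ (.inl i) = bW i := bW.sumQuot_inl bQ i
  refine ⟨_, _, bW.sumQuot bQ, fun i => h_inl i ▸ (bW i).2, ?_, fun x hx => ?_⟩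
  · have h := bQ.linearIndependent.map' (Submodule.mapQ _ U V.subtype le_rfl)
      (Submodule.ker_liftQ_eq_bot _ _ _ (by rw [LinearMap.ker_comp, Submodule.ker_mkQ]))
    convert! h using 2 with i
    rw [Function.comp_apply, ← bW.sumQuot_inr bQ]
    rfl
  · have h_top := Submodule.map_mono (f := V.subtype ∘ₗ Submodule.subtype _) bW.span_eq.ge
    rw [Submodule.map_span, ← Set.range_comp] at h_top
    simp only [h_inl]
    exact h_top ⟨⟨⟨x, hx.1⟩, hx.2⟩, trivial, rfl⟩

section FiniteCoideals

variable {k X : Type u} [Field k] [CommRing X] [HopfAlgebra k X] {I : Ideal X}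
  {ι κ : Type*} [Fintype ι] [Fintype κ]

variable (k) in
/-- The right coideal generated by `x`: the span of the right translates of the function `x`. -/
noncomputable def rightCoideal (x : X) : Submodule k X :=
  LinearMap.range (sliceRight.flip (Coalgebra.comul (R := k) x))

instance finiteDimensional_rightCoideal (x : X) : FiniteDimensional k (rightCoideal k x) :=
  finiteDimensional_range_flip_sliceRight _

theorem self_mem_rightCoideal (x : X) : x ∈ rightCoideal k x := ⟨_, sliceRight_counit_comul x⟩

theorem sliceRight_comul_mem_rightCoideal {x v : X} (hv : v ∈ rightCoideal k x)
    (ψ : Module.Dual k X) : sliceRight ψ (Coalgebra.comul v) ∈ rightCoideal k x := by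
  obtain ⟨φ, rfl⟩ := hv
  rw [LinearMap.flip_apply, comul_sliceRight_comul, sliceRight_lTensor]
  exact ⟨_, rfl⟩

theorem exists_eq_sum_tmul {M N : Type*} [AddCommGroup M] [Module k M] [AddCommGroup N]
    [Module k N] {V : Submodule k M} (b : Module.Basis ι k V) {z : M ⊗[k] N}
    (hz : ∀ φ, sliceRight φ z ∈ V) : ∃ a : ι → N, z = ∑ i, (b i : M) ⊗ₜ a i := by
  obtain ⟨y, rfl⟩ := mem_range_rTensor_subtype hz
  obtain ⟨a, rfl⟩ := TensorProduct.eq_repr_basis_left b y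
  exact ⟨a, by rw [Finsupp.sum_fintype _ _ (by simp), map_sum]; rfl⟩

theorem eq_sum_counit_smul {e : ι → X} {a : Matrix ι ι X}
    (h_comul : ∀ j, Coalgebra.comul (R := k) (e j) = ∑ i, e i ⊗ₜ a i j) (j : ι) :
    e j = ∑ i, Coalgebra.counit (R := k) (e i) • a i j := by
  have h := congrArg (TensorProduct.lid k X) (Coalgebra.rTensor_counit_comul (R := k) (e j))
  simpa only [h_comul, map_sum, LinearMap.rTensor_tmul, TensorProduct.lid_tmul, one_smul]
    using h.symm

variable [I.IsHopfIdeal k]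

theorem counit_eq_zero_of_mem {x : X} (hx : x ∈ I) : Coalgebra.counit (R := k) x = 0 :=
  Submodule.IsCoideal.counit_eq_zero (R := k) (I := I.restrictScalars k) hx

theorem inr_inl_mem_of_comul_eq {e : ι ⊕ κ → X} {a : Matrix (ι ⊕ κ) (ι ⊕ κ) X}
    (h_comul : ∀ j, Coalgebra.comul (R := k) (e j) = ∑ i, e i ⊗ₜ a i j)
    (h_inl : ∀ i, e (.inl i) ∈ I)
    (h_inr : LinearIndependent k fun i => Ideal.Quotient.mkₐ k I (e (.inr i))) (i : κ) (j : ι) :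
    a (.inr i) (.inl j) ∈ I := by
  have h : map (Ideal.Quotient.mkₐ k I) (Ideal.Quotient.mkₐ k I)
      (Coalgebra.comul (R := k) (e (.inl j))) = 0 :=
    Submodule.IsCoideal.map_mkQ_comul_eq_zero (R := k) (I := I.restrictScalars k) (h_inl j)
  have h_mk (i : ι) : Ideal.Quotient.mkₐ k I (e (.inl i)) = 0 :=
    Ideal.Quotient.eq_zero_iff_mem.2 (h_inl i)
  simp only [h_comul, map_sum, map_add, map_tmul, Fintype.sum_sum_type, h_mk,
    TensorProduct.zero_tmul, Finset.sum_const_zero, zero_add] at h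
  exact Ideal.Quotient.eq_zero_iff_mem.1 (eq_zero_of_sum_tmul_eq_zero h_inr h i)

theorem inl_mem_map_augmentationIdeal_coinvariants (hI : IsConjStable k I) {e : ι ⊕ κ → X}
    {a : Matrix (ι ⊕ κ) (ι ⊕ κ) X}
    (he : LinearIndependent k e)
    (h_comul : ∀ j, Coalgebra.comul (R := k) (e j) = ∑ i, e i ⊗ₜ a i j)
    (h_inl : ∀ i, e (.inl i) ∈ I)
    (h_inr : LinearIndependent k fun i => Ideal.Quotient.mkₐ k I (e (.inr i))) (j : ι) :
    e (.inl j) ∈ Ideal.map (coinvariants k I).val (augmentationIdeal (coinvariants k I)) := by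
  classical
  have h_mem := inr_inl_mem_of_comul_eq h_comul h_inl h_inr
  rw [eq_sum_counit_smul h_comul, Fintype.sum_sum_type,
    Finset.sum_eq_zero fun i _ => by rw [counit_eq_zero_of_mem (h_inl i), zero_smul], zero_add]
  refine Submodule.sum_mem _ fun i _ => Submodule.smul_of_tower_mem _ _ ?_
  exact (isMultiplicativeMatrix_of_comul_eq he h_comul).inr_inl_mem_map hI h_mem i j

theorem eq_map_augmentationIdeal_coinvariants (hI : IsConjStable k I) :
    I = Ideal.map (coinvariants k I).val (augmentationIdeal (coinvariants k I)) := by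
  refine le_antisymm (fun x hx => ?_) map_augmentationIdeal_coinvariants_le
  let J := Ideal.map (coinvariants k I).val (augmentationIdeal (coinvariants k I))
  obtain ⟨p, q, b, h_inl, h_inr, h_span⟩ :=
    exists_adapted_basis (rightCoideal k x) (I.restrictScalars k)
  choose a ha using fun j => exists_eq_sum_tmul b (sliceRight_comul_mem_rightCoideal (b j).2)
  have he := b.linearIndependent.map' (rightCoideal k x).subtype (Submodule.ker_subtype _)
  have h_mem := inl_mem_map_augmentationIdeal_coinvariants hI (a := .of fun i j => a j i)
    he ha h_inl h_inr
  have h_le := h_span.trans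
    (Submodule.span_le (p := J.restrictScalars k).2 (Set.range_subset_iff.2 h_mem))
  exact h_le ⟨self_mem_rightCoideal x, hx⟩

end FiniteCoideals

end CommHopf

theorem theorem3p4 {k : Type u} [Field k] {X : Type u} [CommRing X] [HopfAlgebra k X]
    (I : Ideal X) (hI : CommHopf.IsHopfIdeal k I) :
    List.TFAE
      [CommHopf.IsNormalHopfIdeal k I,
       ∃ A : Subalgebra k X, CommHopf.IsHopfSubalgebra A ∧
         I = Ideal.map A.val (CommHopf.augmentationIdeal A),
       ∀ x ∈ I, CommHopf.coadjoint k X x ∈ CommHopf.tensorIdeal k I] := by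
  tfae_have 1 → 2 := fun h => by
    obtain ⟨W, g, rfl⟩ := h.exists_eq_mapAugmentation
    exact ⟨_, CommHopf.isHopfSubalgebra_range g, CommHopf.mapAugmentation_eq_map_range g⟩
  tfae_have 2 → 1 := by
    rintro ⟨A, hA, rfl⟩
    let _ := hA.hopfAlgebra
    exact CommHopf.isNormalHopfIdeal_mapAugmentation hA.valBialgHom
  tfae_have 2 → 3 := by
    rintro ⟨A, hA, rfl⟩
    let _ := hA.hopfAlgebra
    exact CommHopf.isConjStable_iff_coadjoint_mem.1
      (CommHopf.isConjStable_mapAugmentation hA.valBialgHom)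
  tfae_have 3 → 2 := fun h => by
    have := hI.isHopfIdeal
    have h_stable := CommHopf.isConjStable_iff_coadjoint_mem.2 h
    exact ⟨_, CommHopf.isHopfSubalgebra_coinvariants h_stable,
      CommHopf.eq_map_augmentationIdeal_coinvariants h_stable⟩
  tfae_finish
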